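/- Definitions. Let $\mathbb{B}$ be a complete Boolean algebra. An antichain in $\mathbb{B}$ is a set of nonzero, pairwise disjoint elements; $\mathrm{Part}(\mathbb{B})$ denotes the set of all maximal antichains in $\mathbb{B}$. For $A,B\in\mathrm{Part}(\mathbb{B})$, $B$ is a refinement of $A$ if for every $b\in B$ there is $a\in A$ with $b\le a$. Let $U$ and $V$ be ultrafilters on $\mathbb{B}$. We write $U\le_{\mathrm{JPR}}V$ if there exist a function $g\colon\mathrm{Part}(\mathbb{B})\to\mathrm{Part}(\mathbb{B})$ and, for each $A\in\mathrm{Part}(\mathbb{B})$, a function $f_A\colon g(A)\to A$ such that (1) for every $A\in\mathrm{Part}(\mathbb{B})$ and every $X\subseteq A$, $\bigvee X\in U$ if and only if $\bigvee f_A^{-1}[X]\in V$; and (2) whenever $A,B\in\mathrm{Part}(\mathbb{B})$ and $B$ is a refinement of $A$, $\bigvee\{a\wedge b : a\in g(A),\ b\in g(B),\ f_B(b)\le f_A(a)\}\in V$. We write $U\equiv_{\mathrm{JPR}}V$ if $U\le_{\mathrm{JPR}}V$ and $V\le_{\mathrm{JPR}}U$. We write $\langle U,\ge\rangle\le_{\mathrm{T}}\langle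 V,\ge\rangle$ (Tukey reducibility) if there exist functions $f\colon U\to V$ and $g\colon V\to U$ such that for all $u\in U$ and $v\in V$, $v\le f(u)$ implies $g(v)\le u$. The Cohen algebra $\mathbb{C}_\omega$ is the unique (up to isomorphism) nontrivial atomless complete Boolean algebra with a countable dense subalgebra. Theorem. Assume $2^{\aleph_0}=\aleph_1$. Then there exist two ultrafilters $U$ and $V$ on $\mathbb{C}_\omega$ such that $U\equiv_{\mathrm{JPR}}V$, $\langle U,\ge\rangle\nleq_{\mathrm{T}}\langle V,\ge\rangle$ and $\langle V,\ge\rangle\nleq_{\mathrm{T}}\langle U,\ge\rangle$. -/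

import Mathlib

/-! ### Ultrafilters on Boolean algebras -/

/-- `U` is an ultrafilter on the Boolean algebra `B`: a proper filter which contains `b` or `bᶜ`
for every `b`. -/
structure IsBooleanUltrafilter {B : Type*} [BooleanAlgebra B] (U : Set B) : Prop where
  isPFilter : Order.IsPFilter U
  bot_notMem : ⊥ ∉ U
  mem_or_compl_mem : ∀ b : B, b ∈ U ∨ bᶜ ∈ U

/-! ### Maximal antichains and refinement -/

/-- An antichain in the sense of Boolean algebras: a set of nonzero, pairwise disjoint elements. -/
def IsBooleanAntichain {B : Type*} [BooleanAlgebra B] (A : Set B) : Prop :=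
  ⊥ ∉ A ∧ A.Pairwise Disjoint

/-- `MaxAntichains B` is the set of all maximal antichains in `B`. -/
def MaxAntichains (B : Type*) [BooleanAlgebra B] : Type _ :=
  {A : Set B // Maximal IsBooleanAntichain A}

/-- `B'` is a refinement of `A`: every element of `B'` lies below some element of `A`. -/
def IsRefinement {B : Type*} [BooleanAlgebra B] (B' A : Set B) : Prop :=
  ∀ b ∈ B', ∃ a ∈ A, b ≤ a

/-! ### The Jipsen-Pinus-Rose ordering -/

/-- The ordering `U ≤_JPR V` of Jipsen, Pinus and Rose. -/
def JPRLe {B C : Type*} [CompleteBooleanAlgebra B] [CompleteBooleanAlgebra C]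
    (U : Set B) (V : Set C) : Prop :=
  ∃ (g : MaxAntichains B → MaxAntichains C) (f : ∀ A : MaxAntichains B, (g A).1 → A.1),
    (∀ (A : MaxAntichains B) (X : Set B), X ⊆ A.1 →
      (sSup X ∈ U ↔ sSup {c : C | ∃ x : (g A).1, (f A x : B) ∈ X ∧ c = x} ∈ V)) ∧
    (∀ A A' : MaxAntichains B, IsRefinement A'.1 A.1 →
      sSup {c : C | ∃ (a : (g A).1) (b : (g A').1),
        (f A' b : B) ≤ (f A a : B) ∧ c = (a : C) ⊓ (b : C)} ∈ V)

/-- JPR-equivalence. -/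
def JPREquiv {B C : Type*} [CompleteBooleanAlgebra B] [CompleteBooleanAlgebra C]
    (U : Set B) (V : Set C) : Prop :=
  JPRLe U V ∧ JPRLe V U

/-! ### Tukey reducibility -/

/-- Tukey reducibility `⟨U, ≥⟩ ≤_T ⟨V, ≥⟩`. -/
def TukeyLe {B : Type*} [BooleanAlgebra B] (U V : Set B) : Prop :=
  ∃ (f : U → V) (g : V → U), ∀ (u : U) (v : V), (v : B) ≤ (f u : B) → (g v : B) ≤ (u : B)

/-! ### The Cohen algebra -/

/-- `B` is (a copy of) the Cohen algebra: the nontrivial atomless complete Boolean algebra with a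
countable dense subalgebra, which is unique up to isomorphism. -/
structure IsCohenAlgebra (B : Type*) [CompleteBooleanAlgebra B] : Prop where
  nontrivial : Nontrivial B
  atomless : ∀ b : B, ¬ IsAtom b
  exists_countable_dense : ∃ D : BooleanSubalgebra B,
    (D : Set B).Countable ∧ ∀ b : B, b ≠ ⊥ → ∃ d ∈ D, d ≠ ⊥ ∧ d ≤ b

/-! The existence of the Cohen algebra: the regular open subsets of the Cantor space. -/

/-- The algebra of regular open subsets of the Cantor space. -/
abbrev CantorRegularOpens : Type :=
  Heyting.Regular (TopologicalSpace.Opens (ℕ → Bool))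

noncomputable instance instCompleteBooleanAlgebraCantorRegularOpens :
    CompleteBooleanAlgebra CantorRegularOpens where
  __ := (inferInstance : BooleanAlgebra CantorRegularOpens)
  sSup s := Heyting.Regular.toRegular (sSup ((↑) '' s))
  sInf s := Heyting.Regular.toRegular (sInf ((↑) '' s))
  isLUB_sSup s := Heyting.Regular.gi.isLUB_of_u_image (isLUB_sSup _)
  isGLB_sInf s := by
    refine ⟨fun r hr => ?_, fun r hr => ?_⟩
    · exact Heyting.Regular.gi.gc.l_le (sInf_le (Set.mem_image_of_mem _ hr))
    · rw [← Heyting.Regular.toRegular_coe r]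
      refine Heyting.Regular.gi.gc.monotone_l (le_sInf ?_)
      rintro _ ⟨t, ht, rfl⟩
      exact hr ht

theorem cantor_coe_compl_of_isClosed (U : TopologicalSpace.Opens (ℕ → Bool))
    (hU : IsClosed (U : Set (ℕ → Bool))) :
    ((Uᶜ : TopologicalSpace.Opens (ℕ → Bool)) : Set (ℕ → Bool)) = (U : Set (ℕ → Bool))ᶜ := by
  rw [TopologicalSpace.Opens.coe_compl_eq_interior_compl, hU.isOpen_compl.interior_eq]

theorem cantor_isRegular_of_isClosed (U : TopologicalSpace.Opens (ℕ → Bool))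
    (hU : IsClosed (U : Set (ℕ → Bool))) : Heyting.IsRegular U := by
  apply TopologicalSpace.Opens.ext
  rw [cantor_coe_compl_of_isClosed, cantor_coe_compl_of_isClosed U hU, compl_compl]
  rw [cantor_coe_compl_of_isClosed U hU]
  exact U.isOpen.isClosed_compl

/-- The subalgebra of clopen sets. -/
def cantorClopens : BooleanSubalgebra CantorRegularOpens where
  carrier := {R | IsClosed ((R : TopologicalSpace.Opens (ℕ → Bool)) : Set (ℕ → Bool))}
  supClosed' := by
    intro R hR S hS
    simp only [Set.mem_ofPred_eq] at hR hS ⊢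
    have h : IsClosed (((R : TopologicalSpace.Opens (ℕ → Bool)) ⊔ S :
        TopologicalSpace.Opens (ℕ → Bool)) : Set (ℕ → Bool)) := by
      rw [TopologicalSpace.Opens.coe_sup]; exact hR.union hS
    have h2 := Heyting.Regular.coe_sup R S
    rw [cantor_isRegular_of_isClosed _ h] at h2
    have h3 := congrArg (fun W : TopologicalSpace.Opens (ℕ → Bool) => IsClosed (W : Set (ℕ → Bool))) h2
    exact h3.mpr h
  infClosed' := by
    intro R hR S hS
    exact IsClosed.inter hR hS
  compl_mem' := by
    intro R hR
    have h := cantor_coe_compl_of_isClosed _ hR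
    have h2 : IsClosed (((R : TopologicalSpace.Opens (ℕ → Bool))ᶜ :
        TopologicalSpace.Opens (ℕ → Bool)) : Set (ℕ → Bool)) := by
      rw [h]; exact R.val.isOpen.isClosed_compl
    exact h2
  bot_mem' := isClosed_empty

theorem cantorClopens_exists_between (W : TopologicalSpace.Opens (ℕ → Bool)) (hW : W ≠ ⊥) :
    ∃ d ∈ cantorClopens, d ≠ ⊥ ∧ (d : TopologicalSpace.Opens (ℕ → Bool)) < W := by
  obtain ⟨x, hx⟩ : (W : Set (ℕ → Bool)).Nonempty := by
    rw [Set.nonempty_iff_ne_empty]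
    exact fun h => hW (TopologicalSpace.Opens.ext h)
  have hlim : Filter.Tendsto (fun n : ℕ => Function.update x n (!(x n))) Filter.atTop (nhds x) := by
    rw [tendsto_pi_nhds]
    intro i
    refine tendsto_const_nhds.congr' ?_
    filter_upwards [Filter.eventually_gt_atTop i] with n hn
    rw [Function.update_of_ne hn.ne]
  obtain ⟨n, hn⟩ := (hlim.eventually (W.isOpen.mem_nhds hx)).exists
  have hK : IsOpen ((W : Set (ℕ → Bool)) ∩ {y | y n = x n}) :=
    W.isOpen.inter ((isOpen_discrete ({x n} : Set Bool)).preimage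
      (continuous_apply (A := fun _ : ℕ => Bool) n))
  obtain ⟨V, hV, hxV, hVK⟩ := compact_exists_isClopen_in_isOpen hK ⟨hx, rfl⟩
  refine ⟨⟨⟨V, hV.isOpen⟩, cantor_isRegular_of_isClosed _ hV.isClosed⟩, hV.isClosed, ?_, ?_⟩
  · intro h
    have h2 : x ∈ ((⊥ : CantorRegularOpens) : TopologicalSpace.Opens (ℕ → Bool)) := by
      rw [← h]; exact hxV
    exact h2
  · refine lt_of_le_of_ne (fun y hy => (hVK hy).1) fun h => ?_
    have h2 : Function.update x n (!(x n)) ∈ V := by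
      have h3 : Function.update x n (!(x n)) ∈ W := hn
      rw [← h] at h3
      exact h3
    have h4 := (hVK h2).2
    simp at h4

/-- The regular open algebra of the Cantor space is the Cohen algebra. -/
theorem isCohenAlgebra_cantorRegularOpens : IsCohenAlgebra CantorRegularOpens where
  nontrivial := by
    refine ⟨⟨⊥, ⊤, fun h => ?_⟩⟩
    have h2 : (fun _ => true : ℕ → Bool) ∈
        ((⊥ : CantorRegularOpens) : TopologicalSpace.Opens (ℕ → Bool)) := by
      rw [h]; trivial
    exact h2
  atomless := by
    intro b hb
    obtain ⟨d, -, hd, hlt⟩ := cantorClopens_exists_between b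
      (fun h => hb.1 (Heyting.Regular.coe_injective h))
    exact hd (hb.2 d hlt)
  exists_countable_dense := by
    refine ⟨cantorClopens, ?_, ?_⟩
    · have : Countable (TopologicalSpace.Clopens (ℕ → Bool)) :=
        TopologicalSpace.Clopens.countable_iff_secondCountable.mpr inferInstance
      rw [← Set.countable_coe_iff]
      refine Function.Injective.countable
        (f := fun R : (cantorClopens : Set CantorRegularOpens) =>
          (⟨R.1.val, R.2, R.1.val.isOpen⟩ : TopologicalSpace.Clopens (ℕ → Bool))) ?_
      intro R S h
      apply Subtype.ext
      apply Heyting.Regular.coe_injective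
      apply TopologicalSpace.Opens.ext
      exact congrArg (fun K : TopologicalSpace.Clopens (ℕ → Bool) => (K : Set (ℕ → Bool))) h
    · intro b hb
      obtain ⟨d, hd, hd0, hlt⟩ := cantorClopens_exists_between b
        (fun h => hb (Heyting.Regular.coe_injective h))
      exact ⟨d, hd, hd0, hlt.le⟩

open Filter

/-! ### Generic towers of length `ω₁` -/

/-! Fix a countable maximal antichain `p` and a sequence `e` whose nonzero values are dense. Each
ultrafilter is generated by the joins of tails of ω₁ many sequences of elements below the `p n`,
descending modulo finite sets; at each stage the two sides have the same support modulo finite sets.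
There are at most continuum many requirements, so under CH a recursion of length ω₁ meets them all.

JPR-equivalence comes from the common supports. Given a maximal antichain `A`, from some stage on
almost every term on one side lies below a single `h n ∈ A`. Whether `sSup X` belongs to the
ultrafilter then depends only on whether `h n ∈ X` for almost all `n` in the support, which the
other side sees equally well; so `p n ↦ h n` is a reduction (`iSup_mem_towerFilter_iff`,
`jprLe_towerFilter`).

Tukey incomparability comes from the freedom inside each `p n`. A Tukey reduction yields a monotone
map `g` sending bases to bases. Long gaps in the supports make `g`, on tails of late stages, agree
with a map coded by a countable relation (`exists_codedMap_eq`). Such relations can be listed, and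
`TowerCond.exists_stronger_kills` diagonalises against each of them. Fusion (`exists_fusion`,
`TowerCond.exists_lower`) carries the recursion through limits and creates the gaps. -/

theorem exists_generic_tower {P T ι : Type*} (r : P → P → Prop)
    (hr : ∀ x y z, r x y → r y z → r x z) (hP : Nonempty P)
    (hlow : ∀ S : Set P, S.Countable → S.Nonempty →
      (∀ x ∈ S, ∀ y ∈ S, x = y ∨ r x y ∨ r y x) → ∃ q, ∀ x ∈ S, r q x)
    (D : T → Set P) (hD : ∀ t p, ∃ q ∈ D t, r q p)
    [LinearOrder ι] [WellFoundedLT ι] (hι : ∀ i : ι, (Set.Iio i).Countable) (s : ι → T) :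
    ∃ F : ι → P, (∀ α β, α < β → r (F β) (F α)) ∧ ∀ α, F α ∈ D (s α) := by
  classical
  -- The default `hP.some` is never taken: `key` shows inductively that a suitable `q` exists.
  let F : ι → P := WellFoundedLT.fix (motive := fun _ => P) fun β ih =>
    if h : ∃ q ∈ D (s β), ∀ α (hα : α < β), r q (ih α hα) then h.choose else hP.some
  have hF : ∀ β, F β = if h : ∃ q ∈ D (s β), ∀ α, α < β → r q (F α) then h.choose
      else hP.some := fun β => by
    simp only [F]
    exact WellFoundedLT.fix_eq _ β
  have key : ∀ β, F β ∈ D (s β) ∧ ∀ α, α < β → r (F β) (F α) := by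
    intro β
    induction β using WellFoundedLT.induction with
    | ind β ih =>
      have h : ∃ q ∈ D (s β), ∀ α, α < β → r q (F α) := by
        rcases (Set.Iio β).eq_empty_or_nonempty with h0 | h0
        · obtain ⟨q, hq, -⟩ := hD (s β) hP.some
          refine ⟨q, hq, fun α hα => ?_⟩
          exact absurd (show α ∈ Set.Iio β from hα) (by simp [h0])
        · obtain ⟨q₀, hq₀⟩ := hlow (F '' Set.Iio β) ((hι β).image F) (h0.image F) (by
            rintro _ ⟨x, hx, rfl⟩ _ ⟨y, hy, rfl⟩
            rcases lt_trichotomy x y with h | h | h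
            · exact Or.inr (Or.inr ((ih y hy).2 x h))
            · exact Or.inl (by rw [h])
            · exact Or.inr (Or.inl ((ih x hx).2 y h)))
          obtain ⟨q, hq, hqr⟩ := hD (s β) q₀
          exact ⟨q, hq, fun α hα => hr _ _ _ hqr (hq₀ _ ⟨α, hα, rfl⟩)⟩
      have h2 := hF β
      rw [dif_pos h] at h2
      rw [h2]
      exact h.choose_spec
  exact ⟨F, fun α β h => (key β).2 α h, fun α => (key α).1⟩

/-- Under the continuum hypothesis there is a well-order of type `ω₁` in which every element of
a set of size at most continuum is listed cofinally often. -/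
theorem exists_cofinal_enumeration
    (hCH : (2 : Cardinal.{0}) ^ Cardinal.aleph0.{0} = Cardinal.aleph 1)
    {T : Type*} (hT : ∃ f : Set ℕ → T, Function.Surjective f) :
    ∃ (ι : Type) (_ : LinearOrder ι) (_ : WellFoundedLT ι) (s : ι → T),
      (∀ i : ι, (Set.Iio i).Countable) ∧
      (∀ S : Set ι, S.Countable → ∃ β, ∀ α ∈ S, α < β) ∧
      ∀ t α, ∃ β, α < β ∧ s β = t := by
  obtain ⟨f, hf⟩ := hT
  let ι := (Cardinal.aleph.{0} 1).ord.ToType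
  have hcard : Cardinal.mk ι = Cardinal.aleph 1 := Cardinal.mk_ord_toType _
  have hIio : ∀ i : ι, (Set.Iio i).Countable := by
    intro i
    rw [← Cardinal.le_aleph0_iff_set_countable, ← Order.lt_succ_iff, Cardinal.succ_aleph0]
    refine (Cardinal.mk_Iio_lt i ?_).trans_eq hcard
    rw [hcard]
    exact (Ordinal.type_toType _).symm
  have hIic : ∀ i : ι, (Set.Iic i).Countable := by
    intro i
    rw [← Set.Iio_insert]
    exact (hIio i).insert i
  have hunc : ¬ (Set.univ : Set ι).Countable := by
    rw [← Cardinal.le_aleph0_iff_set_countable, Cardinal.mk_univ, hcard, not_le]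
    exact Cardinal.aleph0_lt_aleph_one
  have hbd : ∀ S : Set ι, S.Countable → ∃ β, ∀ α ∈ S, α < β := by
    intro S hS
    by_contra! h
    refine hunc ((hS.biUnion fun α _ => hIic α).mono fun β _ => ?_)
    obtain ⟨α, hα, hβ⟩ := h β
    exact Set.mem_biUnion hα hβ
  -- This is where CH enters. A bijection of `ι × Set ℕ` with `ι` lists each set uncountably often,
  -- hence cofinally, as initial segments are countable.
  have hprod : Cardinal.mk (ι × Set ℕ) = Cardinal.mk ι := by
    rw [Cardinal.mk_prod, Cardinal.mk_set, hcard]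
    simp only [Cardinal.lift_id, Cardinal.mk_nat, hCH]
    exact Cardinal.mul_eq_self (Cardinal.aleph0_le_aleph 1)
  obtain ⟨E⟩ := Cardinal.eq.1 hprod
  refine ⟨ι, inferInstance, inferInstance, fun i => f (E.symm i).2, hIio, hbd, ?_⟩
  intro t α
  obtain ⟨u, rfl⟩ := hf t
  by_contra! h
  refine hunc (((hIic α).image fun i => (E.symm i).1).mono fun j _ => ?_)
  refine ⟨E (j, u), ?_, by simp⟩
  by_contra h2
  exact h (E (j, u)) (not_le.1 h2) (by simp)

/-! ### Fusion of sequences with gaps -/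

/-- The initial segment of length `n` of a sequence. -/
def seqPrefix (x : ℕ → ℕ) (n : ℕ) : List ℕ := (List.range n).map x

theorem seqPrefix_eq_iff {x y : ℕ → ℕ} {n : ℕ} :
    seqPrefix x n = seqPrefix y n ↔ ∀ j < n, x j = y j := by
  simp [seqPrefix]

@[simp] theorem length_seqPrefix (x : ℕ → ℕ) (n : ℕ) : (seqPrefix x n).length = n := by
  simp [seqPrefix]

/-- The sequence `x` with its first `m` entries replaced by `0`. -/
def seqTail (m : ℕ) (x : ℕ → ℕ) : ℕ → ℕ := fun j => if j < m then 0 else x j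

theorem seqTail_zero (x : ℕ → ℕ) : seqTail 0 x = x := by
  funext j; simp [seqTail]

/-- The place `a (i + 1)` is chosen once both sequences are known up to `a i`. It can therefore
exceed the finitely many bounds `N j` computed from those initial segments, and the sequences vanish
in between. -/
theorem exists_fusion (Q : ℕ → ℕ → Prop) (hQ : ∀ i, ∃ᶠ n in atTop, Q i n)
    (w : ℕ → Bool → ℕ → ℕ) (N : ℕ → List ℕ → ℕ) :
    ∃ (a : ℕ → ℕ) (x : Bool → ℕ → ℕ), StrictMono a ∧ (∀ i, Q i (a i)) ∧
      (∀ i b, x b (a i) = w i b (a i)) ∧ (∀ b n, n ∉ Set.range a → x b n = 0) ∧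
      ∀ i b, ∀ j ≤ i, ∀ m ≤ a i, N j (seqPrefix (seqTail m (x b)) (a i + 1)) ≤ a (i + 1) := by
  classical
  have h0 : ∀ i L, ∃ n, L ≤ n ∧ Q i n := fun i L => by
    obtain ⟨n, hn, h⟩ := frequently_atTop.1 (hQ i) L
    exact ⟨n, hn, h⟩
  choose nx hnx hnxQ using h0
  let bnd : ℕ → ℕ → (Bool → ℕ → ℕ) → ℕ := fun i a x =>
    (Finset.range (i + 1) ×ˢ Finset.range (a + 1) ×ˢ (Finset.univ : Finset Bool)).sup
      fun t => N t.1 (seqPrefix (seqTail t.2.1 (x t.2.2)) (a + 1))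
  -- The state holds the current place `a i` and the two sequences built so far, set to `0` beyond
  -- `a i`.
  let st : ℕ → ℕ × (Bool → ℕ → ℕ) := fun i => Nat.rec
    (nx 0 0, fun b n => if n = nx 0 0 then w 0 b n else 0)
    (fun i s => (nx (i + 1) (max (s.1 + 1) (bnd i s.1 s.2)),
      fun b n => if n = nx (i + 1) (max (s.1 + 1) (bnd i s.1 s.2)) then w (i + 1) b n
        else s.2 b n)) i
  let a : ℕ → ℕ := fun i => (st i).1
  have ha : ∀ i, a (i + 1) = nx (i + 1) (max (a i + 1) (bnd i (a i) (st i).2)) := fun i => rfl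
  have hst0 : ∀ b n, (st 0).2 b n = if n = a 0 then w 0 b n else 0 := fun b n => rfl
  have hst : ∀ i b n, (st (i + 1)).2 b n = if n = a (i + 1) then w (i + 1) b n
    else (st i).2 b n := fun i b n => rfl
  have hmono : StrictMono a := strictMono_nat_of_lt_succ fun i => by
    rw [ha]
    exact lt_of_lt_of_le (Nat.lt_succ_self _) ((le_max_left _ _).trans (hnx _ _))
  have hb : ∀ i, bnd i (a i) (st i).2 ≤ a (i + 1) := fun i => by
    rw [ha i]
    exact (le_max_right _ _).trans (hnx _ _)
  have hQa : ∀ i, Q i (a i) := by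
    intro i
    cases i with
    | zero => exact hnxQ 0 0
    | succ i => rw [ha]; exact hnxQ _ _
  clear_value a st
  let x : Bool → ℕ → ℕ := fun b n => if h : ∃ i, a i = n then w h.choose b n else 0
  have hxa : ∀ i b, x b (a i) = w i b (a i) := by
    intro i b
    have h : ∃ i', a i' = a i := ⟨i, rfl⟩
    have h2 : h.choose = i := hmono.injective h.choose_spec
    simp only [x, dif_pos h]
    rw [h2]
  have hx0 : ∀ b n, n ∉ Set.range a → x b n = 0 := by
    intro b n hn
    exact dif_neg hn
  have hagree : ∀ i b n, (st i).2 b n = if n ≤ a i then x b n else 0 := by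
    intro i
    induction i with
    | zero =>
      intro b n
      rw [hst0]
      split_ifs with h1 h2 h2
      · rw [h1, hxa]
      · omega
      · refine (hx0 b n ?_).symm
        rintro ⟨k, rfl⟩
        have := hmono.monotone (Nat.zero_le k)
        omega
      · rfl
    | succ i ih =>
      intro b n
      rw [hst, ih]
      have : a i < a (i + 1) := hmono (Nat.lt_succ_self i)
      split_ifs with h1 h2 h3 h4 h5
      · rw [h1, hxa]
      · omega
      · rfl
      · omega
      · refine (hx0 b n ?_).symm
        rintro ⟨k, rfl⟩
        have h6 := hmono.lt_iff_lt.1 (not_le.1 h3)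
        have h7 := hmono.le_iff_le.1 h5
        have : k = i + 1 := by omega
        exact h1 (by rw [this])
      · rfl
  refine ⟨a, x, hmono, hQa, hxa, hx0, fun i b j hj m hm => ?_⟩
  have h1 : seqPrefix (seqTail m (x b)) (a i + 1) =
      seqPrefix (seqTail m ((st i).2 b)) (a i + 1) := by
    rw [seqPrefix_eq_iff]
    intro l hl
    simp only [seqTail, hagree]
    rw [if_pos (show l ≤ a i by omega)]
  rw [h1]
  refine le_trans ?_ (hb i)
  exact Finset.le_sup (f := fun t : ℕ × ℕ × Bool =>
    N t.1 (seqPrefix (seqTail t.2.1 ((st i).2 t.2.2)) (a i + 1)))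
    (b := (j, m, b)) (by simp; omega)

/-! ### Forcing conditions: a σ-closed order -/

section Conditions

variable {B : Type*} [CompleteBooleanAlgebra B] {e p : ℕ → B}

/-- The sequence of codes `x` has gaps with respect to `N`: each of its tails vanishes,
infinitely often, on an interval `[n, N s)` where `s` is the initial segment of length `n`. -/
def HasGaps (e : ℕ → B) (N : List ℕ → ℕ) (x : ℕ → ℕ) : Prop :=
  ∀ m, ∃ᶠ n in atTop, ∀ j, n ≤ j → j < N (seqPrefix (seqTail m x) n) → e (x j) = ⊥

/-- A forcing condition: two sequences of (codes of) elements below the elements of the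
antichain `p`, with the same infinite support up to finite sets, and countably many promises
about gaps. -/
structure TowerCond (e p : ℕ → B) where
  c : Bool → ℕ → ℕ
  gapFns : Set (List ℕ → ℕ)
  le : ∀ i n, e (c i n) ≤ p n
  supp : ∀ i j, ∀ᶠ n in atTop, e (c i n) ≠ ⊥ → e (c j n) ≠ ⊥
  inf : ∀ i, ∃ᶠ n in atTop, e (c i n) ≠ ⊥
  countable : gapFns.Countable

/-- The condition `q` is stronger than `q'` and keeps its promises. -/
def TowerCond.Stronger (q q' : TowerCond e p) : Prop :=
  (∀ i, ∀ᶠ n in atTop, e (q.c i n) ≤ e (q'.c i n)) ∧ q'.gapFns ⊆ q.gapFns ∧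
    ∀ i, ∀ N ∈ q'.gapFns, HasGaps e N (q.c i)

theorem TowerCond.Stronger.trans (x y z : TowerCond e p) (h : x.Stronger y) (h' : y.Stronger z) :
    x.Stronger z := by
  refine ⟨fun i => ?_, h'.2.1.trans h.2.1, fun i N hN => h.2.2 i N (h'.2.1 hN)⟩
  filter_upwards [h.1 i, h'.1 i] with n h1 h2 using h1.trans h2

theorem TowerCond.frequently_forall (q : TowerCond e p) :
    ∃ᶠ n in atTop, ∀ i, e (q.c i n) ≠ ⊥ := by
  refine ((q.inf false).and_eventually (q.supp false true)).mono fun n hn i => ?_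
  cases i
  · exact hn.1
  · exact hn.2 hn.1

/-- Diagonalise along a descending sequence cofinal in the chain, at places so sparse that all
promises are kept. `Stronger` is not reflexive, so the case of a singleton `S` already has content:
it creates gaps. The last clause, that values are only copied or erased, serves that case. -/
theorem TowerCond.exists_lower (he : e 0 = ⊥) (S : Set (TowerCond e p)) (hS : S.Countable)
    (hne : S.Nonempty) (hchain : ∀ x ∈ S, ∀ y ∈ S, x = y ∨ x.Stronger y ∨ y.Stronger x) :
    ∃ q : TowerCond e p, (∀ x ∈ S, q.Stronger x) ∧
      ∀ n, (∀ b, q.c b n = 0) ∨ ∃ x ∈ S, ∀ b, q.c b n = x.c b n := by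
  obtain ⟨s, rfl⟩ := hS.exists_eq_range hne
  have hmin : ∀ i, ∃ y ∈ Set.range s, ∀ j ≤ i, y = s j ∨ y.Stronger (s j) := by
    intro i
    induction i with
    | zero =>
      refine ⟨s 0, ⟨0, rfl⟩, fun j hj => ?_⟩
      obtain rfl : j = 0 := by omega
      exact Or.inl rfl
    | succ i ih =>
      obtain ⟨y, hy, hys⟩ := ih
      have hcase : y.Stronger (s (i + 1)) ∨ y = s (i + 1) ∨ (s (i + 1)).Stronger y := by
        rcases hchain y hy _ ⟨i + 1, rfl⟩ with h | h | h
        · exact Or.inr (Or.inl h)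
        · exact Or.inl h
        · exact Or.inr (Or.inr h)
      rcases hcase with h | h | h
      · refine ⟨y, hy, fun j hj => ?_⟩
        rcases Nat.lt_or_ge i j with h1 | h1
        · obtain rfl : j = i + 1 := by omega
          exact Or.inr h
        · exact hys j h1
      · refine ⟨y, hy, fun j hj => ?_⟩
        rcases Nat.lt_or_ge i j with h1 | h1
        · obtain rfl : j = i + 1 := by omega
          exact Or.inl h
        · exact hys j h1
      · refine ⟨s (i + 1), ⟨_, rfl⟩, fun j hj => ?_⟩
        rcases Nat.lt_or_ge i j with h1 | h1
        · obtain rfl : j = i + 1 := by omega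
          exact Or.inl rfl
        · rcases hys j h1 with h2 | h2
          · exact Or.inr (h2 ▸ h)
          · exact Or.inr (h.trans _ _ _ h2)
  choose y hyS hy using hmin
  -- The zero function makes the set of promises nonempty, hence enumerable; its own promise is
  -- vacuous.
  have hcount : (insert (fun _ => 0) (⋃ i, (s i).gapFns)).Countable :=
    (Set.countable_iUnion fun i => (s i).countable).insert _
  obtain ⟨N, hN⟩ := hcount.exists_eq_range (Set.insert_nonempty _ _)
  obtain ⟨a, x, hmono, hQ, hxa, hx0, hgap⟩ := exists_fusion
    (fun i n => (∀ b, e ((y i).c b n) ≠ ⊥) ∧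
      ∀ j ∈ Finset.range (i + 1), ∀ b, e ((y i).c b n) ≤ e ((s j).c b n))
    (fun i => by
      refine (y i).frequently_forall.and_eventually ?_
      rw [eventually_all_finset]
      intro j hj
      rw [eventually_all]
      intro b
      rcases hy i j (by simpa [Nat.lt_succ_iff] using hj) with h | h
      · rw [h]; exact Eventually.of_forall fun n => le_rfl
      · exact h.1 b)
    (fun i => (y i).c) N
  have hran : ∀ b n, e (x b n) ≠ ⊥ → n ∈ Set.range a := by
    intro b n h
    by_contra h2
    exact h (by rw [hx0 b n h2, he])
  refine ⟨⟨x, Set.range N, ?_, ?_, ?_, Set.countable_range N⟩, ?_, ?_⟩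
  · intro b n
    by_cases h : n ∈ Set.range a
    · obtain ⟨i, rfl⟩ := h
      rw [hxa]
      exact (y i).le b _
    · rw [hx0 b n h, he]; exact bot_le
  · intro b b'
    refine Eventually.of_forall fun n h => ?_
    obtain ⟨i, rfl⟩ := hran b n h
    rw [hxa]
    exact (hQ i).1 b'
  · intro b
    rw [frequently_atTop]
    intro n
    refine ⟨a n, hmono.le_apply, ?_⟩
    rw [hxa]
    exact (hQ n).1 b
  · rintro _ ⟨j, rfl⟩
    refine ⟨fun b => ?_, ?_, ?_⟩
    · filter_upwards [eventually_ge_atTop (a j)] with n hn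
      by_cases h : n ∈ Set.range a
      · obtain ⟨i, rfl⟩ := h
        have hij := hmono.le_iff_le.1 hn
        simp only [hxa]
        exact (hQ i).2 j (by simpa [Nat.lt_succ_iff] using hij) b
      · simp only [hx0 b n h, he]; exact bot_le
    · change (s j).gapFns ⊆ Set.range N
      rw [← hN]
      exact (Set.subset_iUnion (fun i => (s i).gapFns) j).trans (Set.subset_insert _ _)
    · intro b M hM m
      obtain ⟨k, rfl⟩ : M ∈ Set.range N := by
        rw [← hN]
        exact Or.inr (Set.mem_iUnion.2 ⟨j, hM⟩)
      rw [frequently_atTop]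
      intro L
      have hle := hmono.le_apply (x := max k (max m L))
      -- The gap starts just after a place `a I` and ends by `a (I + 1)`, so it contains no place of
      -- the support.
      refine ⟨a (max k (max m L)) + 1, by omega, fun l hl1 hl2 => ?_⟩
      have h := hgap (max k (max m L)) b k (le_max_left _ _) m (by omega)
      have hl3 := hl2.trans_le h
      change e (x b l) = ⊥
      rw [hx0 b l, he]
      rintro ⟨i, rfl⟩
      have h1 := hmono.lt_iff_lt.1 hl3
      have h2 := hmono.lt_iff_lt.1 (show a (max k (max m L)) < a i by omega)
      omega
  · intro n
    by_cases h : n ∈ Set.range a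
    · obtain ⟨i, rfl⟩ := h
      exact Or.inr ⟨y i, hyS i, fun b => hxa i b⟩
    · exact Or.inl fun b => hx0 b n h

/-- Erasing `y` wherever a side vanishes or fails to lie below `q` gives a condition `q₀` which may
lack the promised gaps. `exists_lower` applied to `{q₀}` supplies them. -/
theorem TowerCond.exists_shrink (he : e 0 = ⊥) (q : TowerCond e p) (y : Bool → ℕ → ℕ)
    (h1 : ∀ i, ∀ᶠ n in atTop, e (y i n) ≤ e (q.c i n))
    (h2 : ∃ᶠ n in atTop, ∀ i, e (y i n) ≠ ⊥) :
    ∃ q' : TowerCond e p, q'.Stronger q ∧ ∀ i n, e (q'.c i n) ≤ e (y i n) := by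
  classical
  let P : ℕ → Prop := fun n => ∀ i, e (y i n) ≠ ⊥ ∧ e (y i n) ≤ e (q.c i n)
  let x : Bool → ℕ → ℕ := fun i n => if P n then y i n else 0
  have hx1 : ∀ i n, P n → x i n = y i n := fun i n h => if_pos h
  have hx0 : ∀ i n, ¬ P n → e (x i n) = ⊥ := fun i n h => by
    simp only [x, if_neg h, he]
  have hP : ∃ᶠ n in atTop, P n :=
    (h2.and_eventually (eventually_all.2 h1)).mono fun n hn i => ⟨hn.1 i, hn.2 i⟩
  have hxq : ∀ i n, e (x i n) ≤ e (q.c i n) := fun i n => by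
    by_cases h : P n
    · rw [hx1 i n h]; exact (h i).2
    · rw [hx0 i n h]; exact bot_le
  have hxy : ∀ i n, e (x i n) ≤ e (y i n) := fun i n => by
    by_cases h : P n
    · rw [hx1 i n h]
    · rw [hx0 i n h]; exact bot_le
  let q₀ : TowerCond e p := ⟨x, q.gapFns, fun i n => (hxq i n).trans (q.le i n), by
    intro i j
    refine Eventually.of_forall fun n h => ?_
    have h3 : P n := by
      by_contra h3
      exact h (hx0 i n h3)
    rw [hx1 j n h3]
    exact (h3 j).1, fun i => hP.mono fun n h3 => by
      rw [hx1 i n h3]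
      exact (h3 i).1, q.countable⟩
  obtain ⟨q', hq', hval⟩ := exists_lower he {q₀} (Set.countable_singleton _)
    (Set.singleton_nonempty _) (by rintro _ rfl _ rfl; exact Or.inl rfl)
  have hr := hq' q₀ rfl
  refine ⟨q', ⟨fun i => ?_, hr.2.1, hr.2.2⟩, fun i n => ?_⟩
  · filter_upwards [hr.1 i] with n hn using hn.trans (hxq i n)
  · rcases hval n with h | ⟨_, rfl, h⟩
    · rw [h i, he]; exact bot_le
    · rw [h i]; exact hxy i n

/-- The other side keeps its values; places where `y` vanishes are lost on both sides. -/
theorem TowerCond.exists_shrink_side (he : e 0 = ⊥) (q : TowerCond e p) (i : Bool) (y : ℕ → ℕ)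
    (h1 : ∀ n, e (y n) ≤ e (q.c i n)) (h2 : ∃ᶠ n in atTop, e (y n) ≠ ⊥) :
    ∃ q' : TowerCond e p, q'.Stronger q ∧ ∀ n, e (q'.c i n) ≤ e (y n) := by
  obtain ⟨q', hq', h⟩ := q.exists_shrink he (fun j => if j = i then y else q.c j)
    (fun j => Eventually.of_forall fun n => by
      by_cases hj : j = i
      · subst hj; simpa using h1 n
      · simp [hj])
    (by
      refine (h2.and_eventually (eventually_all.2 (q.supp i))).mono fun n hn j => ?_
      by_cases hj : j = i
      · subst hj; simpa using hn.1
      · simp only [if_neg hj]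
        refine hn.2 j fun h3 => hn.1 ?_
        have := h1 n
        rwa [h3, le_bot_iff] at this)
  refine ⟨q', hq', fun n => ?_⟩
  simpa using h i n

/-! ### Dense sets of conditions -/

theorem TowerCond.exists_stronger_decides (he : e 0 = ⊥)
    (hd : ∀ b : B, b ≠ ⊥ → ∃ k, e k ≠ ⊥ ∧ e k ≤ b) (i : Bool) (b : B) (q : TowerCond e p) :
    ∃ q' : TowerCond e p, ((∀ᶠ n in atTop, e (q'.c i n) ≤ b) ∨
      ∀ᶠ n in atTop, e (q'.c i n) ≤ bᶜ) ∧ q'.Stronger q := by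
  classical
  by_cases h : ∃ᶠ n in atTop, e (q.c i n) ⊓ b ≠ ⊥
  · have : ∀ n, ∃ k, e k ≤ e (q.c i n) ⊓ b ∧ (e (q.c i n) ⊓ b ≠ ⊥ → e k ≠ ⊥) := by
      intro n
      by_cases h2 : e (q.c i n) ⊓ b = ⊥
      · exact ⟨0, by rw [he]; exact bot_le, fun h3 => absurd h2 h3⟩
      · obtain ⟨k, hk, hk2⟩ := hd _ h2
        exact ⟨k, hk2, fun _ => hk⟩
    choose y hy1 hy2 using this
    obtain ⟨q', hq', h3⟩ := q.exists_shrink_side he i y (fun n => (hy1 n).trans inf_le_left)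
      (h.mono fun n => hy2 n)
    exact ⟨q', Or.inl (Eventually.of_forall fun n => (h3 n).trans ((hy1 n).trans inf_le_right)),
      hq'⟩
  · rw [not_frequently] at h
    obtain ⟨q', hq', h3⟩ := q.exists_shrink_side he i (q.c i) (fun n => le_rfl) (q.inf i)
    refine ⟨q', Or.inr ?_, hq'⟩
    filter_upwards [h] with n hn
    exact (h3 n).trans (le_compl_iff_disjoint_right.2 (disjoint_iff.2 (not_not.1 hn)))

theorem exists_inf_ne_bot_of_maximal {A : Set B} (hA : Maximal IsBooleanAntichain A) {b : B}
    (hb : b ≠ ⊥) : ∃ a ∈ A, b ⊓ a ≠ ⊥ := by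
  by_contra! h
  have h1 : IsBooleanAntichain (insert b A) := by
    refine ⟨?_, ?_⟩
    · rintro (h0 | h0)
      · exact hb h0.symm
      · exact hA.1.1 h0
    · refine hA.1.2.insert fun a ha _ => ?_
      exact ⟨disjoint_iff.2 (h a ha), (disjoint_iff.2 (h a ha)).symm⟩
  have h2 : b ∈ A := hA.2 h1 (Set.subset_insert _ _) (Set.mem_insert _ _)
  exact hb (by simpa using h b h2)

theorem TowerCond.exists_stronger_refines (he : e 0 = ⊥)
    (hd : ∀ b : B, b ≠ ⊥ → ∃ k, e k ≠ ⊥ ∧ e k ≤ b) (i : Bool) (A : MaxAntichains B)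
    (q : TowerCond e p) :
    ∃ q' : TowerCond e p, (∀ᶠ n in atTop, e (q'.c i n) ≠ ⊥ → ∃ a ∈ A.1, e (q'.c i n) ≤ a) ∧
      q'.Stronger q := by
  have : ∀ n, ∃ k, e k ≤ e (q.c i n) ∧
      (e (q.c i n) ≠ ⊥ → e k ≠ ⊥ ∧ ∃ a ∈ A.1, e k ≤ a) := by
    intro n
    by_cases h2 : e (q.c i n) = ⊥
    · exact ⟨0, by rw [he]; exact bot_le, fun h3 => absurd h2 h3⟩
    · obtain ⟨a, ha, h3⟩ := exists_inf_ne_bot_of_maximal A.2 h2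
      obtain ⟨k, hk, hk2⟩ := hd _ h3
      exact ⟨k, hk2.trans inf_le_left, fun _ => ⟨hk, a, ha, hk2.trans inf_le_right⟩⟩
  choose y hy1 hy2 using this
  obtain ⟨q', hq', h3⟩ := q.exists_shrink_side he i y hy1 ((q.inf i).mono fun n hn => (hy2 n hn).1)
  refine ⟨q', Eventually.of_forall fun n hn => ?_, hq'⟩
  have h4 : e (q.c i n) ≠ ⊥ := by
    intro h4
    have := (h3 n).trans (hy1 n)
    rw [h4, le_bot_iff] at this
    exact hn this
  obtain ⟨-, a, ha, h5⟩ := hy2 n h4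
  exact ⟨a, ha, (h3 n).trans h5⟩

/-- A new promise binds only later conditions, so it can be added without changing the sequences. -/
theorem TowerCond.exists_stronger_mem_gapFns (he : e 0 = ⊥) (N : List ℕ → ℕ)
    (q : TowerCond e p) : ∃ q' : TowerCond e p, N ∈ q'.gapFns ∧ q'.Stronger q := by
  obtain ⟨q', hq', -⟩ := q.exists_shrink_side he false (q.c false) (fun n => le_rfl) (q.inf false)
  exact ⟨⟨q'.c, insert N q'.gapFns, q'.le, q'.supp, q'.inf, q'.countable.insert N⟩,
    Set.mem_insert _ _, hq'.1, hq'.2.1.trans (Set.subset_insert _ _), hq'.2.2⟩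

/-- The monotone map on sequences of codes that is coded by the relation `Ψ`. -/
def codedMap (e : ℕ → B) (Ψ : Set (List ℕ × ℕ)) (x : ℕ → ℕ) : B :=
  sSup {b | ∃ k n y, b = e k ∧ (∀ l < n, e (y l) ≤ e (x l)) ∧ (seqPrefix y n, k) ∈ Ψ}

theorem codedMap_mono (Ψ : Set (List ℕ × ℕ)) {x x' : ℕ → ℕ} (h : ∀ n, e (x n) ≤ e (x' n)) :
    codedMap e Ψ x ≤ codedMap e Ψ x' := by
  refine sSup_le_sSup ?_
  rintro _ ⟨k, n, y, rfl, h1, h2⟩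
  exact ⟨k, n, y, rfl, fun l hl => (h1 l hl).trans (h l), h2⟩

/-- The condition `q` ensures that the map coded by `Ψ` does not send a base of the ultrafilter
on side `j` to a base of the ultrafilter on the other side. -/
def TowerCond.Kills (q : TowerCond e p) (Ψ : Set (List ℕ × ℕ)) (j : Bool) : Prop :=
  (∃ b, (∀ᶠ n in atTop, e (q.c (!j) n) ≤ bᶜ) ∧ codedMap e Ψ (q.c j) ≤ b) ∨
  ∃ b, (∀ᶠ n in atTop, e (q.c (!j) n) ≤ b) ∧
    ∀ z : ℕ → ℕ, (∃ᶠ n in atTop, e (z n) ≠ ⊥) → (∀ᶠ n in atTop, e (z n) ≤ e (q.c j n)) →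
      ¬ codedMap e Ψ z ≤ b

theorem exists_disjoint_codes (hd : ∀ b : B, b ≠ ⊥ → ∃ k, e k ≠ ⊥ ∧ e k ≤ b)
    (hat : ∀ b : B, ¬ IsAtom b) {b : B} (hb : b ≠ ⊥) :
    ∃ k l, e k ≠ ⊥ ∧ e l ≠ ⊥ ∧ e k ≤ b ∧ e l ≤ b ∧ Disjoint (e k) (e l) := by
  obtain ⟨x, hx, hx0⟩ : ∃ x, x < b ∧ x ≠ ⊥ := by
    by_contra! h
    exact hat b ⟨hb, h⟩
  have h2 : b \ x ≠ ⊥ := by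
    intro h
    exact hx.not_ge (sdiff_eq_bot_iff.1 h)
  obtain ⟨k, hk, hk2⟩ := hd x hx0
  obtain ⟨l, hl, hl2⟩ := hd _ h2
  exact ⟨k, l, hk, hl, hk2.trans hx.le, hl2.trans sdiff_le, disjoint_sdiff_self_right.mono hk2 hl2⟩

/-- Split side `!j` into disjoint halves `x` and `y`, and let `b` be the join of `x`. If some
admissible `z` on side `j` is mapped below `b`, use `z` there and `y` opposite, so that `bᶜ` becomes
large. If there is none, use `x`: then `b` is large but nothing on side `j` is mapped below it. -/
theorem TowerCond.exists_stronger_kills (he : e 0 = ⊥)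
    (hd : ∀ b : B, b ≠ ⊥ → ∃ k, e k ≠ ⊥ ∧ e k ≤ b) (hat : ∀ b : B, ¬ IsAtom b)
    (hp : Pairwise fun m n => Disjoint (p m) (p n)) (Ψ : Set (List ℕ × ℕ)) (j : Bool)
    (q : TowerCond e p) : ∃ q' : TowerCond e p, q'.Kills Ψ j ∧ q'.Stronger q := by
  have : ∀ n, ∃ k l, e k ≤ e (q.c (!j) n) ∧ e l ≤ e (q.c (!j) n) ∧ Disjoint (e k) (e l) ∧
      (e (q.c (!j) n) ≠ ⊥ → e k ≠ ⊥ ∧ e l ≠ ⊥) := by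
    intro n
    by_cases h2 : e (q.c (!j) n) = ⊥
    · exact ⟨0, 0, by rw [he]; exact bot_le, by rw [he]; exact bot_le, by rw [he]; exact disjoint_bot_left,
        fun h3 => absurd h2 h3⟩
    · obtain ⟨k, l, hk, hl, h3, h4, h5⟩ := exists_disjoint_codes hd hat h2
      exact ⟨k, l, h3, h4, h5, fun _ => ⟨hk, hl⟩⟩
  choose x y hx hy hxy hne using this
  let b : B := ⨆ n, e (x n)
  have hyb : ∀ n, e (y n) ≤ bᶜ := by
    intro n
    rw [le_compl_iff_disjoint_right, disjoint_iSup_iff]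
    intro m
    by_cases h : n = m
    · subst h; exact (hxy n).symm
    · exact (hp h).mono ((hy n).trans (q.le _ n)) ((hx m).trans (q.le _ m))
  by_cases hz : ∃ z : ℕ → ℕ, (∃ᶠ n in atTop, e (z n) ≠ ⊥) ∧
      (∀ᶠ n in atTop, e (z n) ≤ e (q.c j n)) ∧ codedMap e Ψ z ≤ b
  · obtain ⟨z, hz1, hz2, hz3⟩ := hz
    obtain ⟨q', hq', h⟩ := q.exists_shrink he (fun s => if s = j then z else y)
      (fun s => by
        by_cases hs : s = j
        · subst hs; simpa using hz2
        · obtain rfl : s = !j := by cases s <;> cases j <;> simp_all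
          exact Eventually.of_forall fun n => by simpa using hy n)
      (by
        refine (hz1.and_eventually (hz2.and (q.supp j (!j)))).mono ?_
        rintro n ⟨h1, h2, h3⟩ s
        by_cases hs : s = j
        · simpa [hs] using h1
        · simp only [if_neg hs]
          refine (hne n (h3 fun h4 => h1 ?_)).2
          rwa [h4, le_bot_iff] at h2)
    refine ⟨q', Or.inl ⟨b, Eventually.of_forall fun n => ?_, ?_⟩, hq'⟩
    · have := h (!j) n
      simp only [Bool.not_eq_eq_eq_not, Bool.eq_not_self, if_false] at this
      exact this.trans (hyb n)
    · exact (codedMap_mono Ψ fun n => by simpa using h j n).trans hz3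
  · push Not at hz
    obtain ⟨q', hq', h⟩ := q.exists_shrink_side he (!j) x hx ((q.inf _).mono fun n hn => (hne n hn).1)
    refine ⟨q', Or.inr ⟨b, Eventually.of_forall fun n => (h n).trans (le_iSup (fun n => e (x n)) n),
      fun z hz1 hz2 => hz z hz1 ?_⟩, hq'⟩
    filter_upwards [hz2, hq'.1 j] with n h1 h2 using h1.trans h2

end Conditions

/-! ### The ultrafilters generated by a tower -/

section Towers

variable {B : Type*} [CompleteBooleanAlgebra B] {e p : ℕ → B} {ι : Type*}

/-- The filter generated by one side of a tower of conditions. -/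
def towerFilter (F : ι → TowerCond e p) (i : Bool) : Set B :=
  {b | ∃ α, ∀ᶠ n in atTop, e ((F α).c i n) ≤ b}

/-- The element of the algebra coded by a sequence. -/
def seqSup (e : ℕ → B) (x : ℕ → ℕ) : B := ⨆ n, e (x n)

theorem bot_notMem_towerFilter (F : ι → TowerCond e p) (i : Bool) : ⊥ ∉ towerFilter F i := by
  rintro ⟨α, hα⟩
  obtain ⟨n, h1, h2⟩ := (((F α).inf i).and_eventually hα).exists
  exact h1 (le_bot_iff.1 h2)

theorem mem_towerFilter_of_le {F : ι → TowerCond e p} {i : Bool} {a b : B}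
    (ha : a ∈ towerFilter F i) (h : a ≤ b) : b ∈ towerFilter F i := by
  obtain ⟨α, hα⟩ := ha
  exact ⟨α, hα.mono fun n hn => hn.trans h⟩

theorem seqSup_mem_towerFilter (F : ι → TowerCond e p) (i : Bool) (α : ι) :
    seqSup e ((F α).c i) ∈ towerFilter F i :=
  ⟨α, Eventually.of_forall fun n => le_iSup (fun n => e ((F α).c i n)) n⟩

variable [LinearOrder ι]

theorem eventually_le_of_le {F : ι → TowerCond e p}
    (hF : ∀ α β, α < β → (F β).Stronger (F α)) (i : Bool) {α β : ι} (h : α ≤ β) :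
    ∀ᶠ n in atTop, e ((F β).c i n) ≤ e ((F α).c i n) := by
  rcases h.eq_or_lt with rfl | h
  · exact Eventually.of_forall fun n => le_rfl
  · exact (hF α β h).1 i

theorem eventually_le_mono {F : ι → TowerCond e p}
    (hF : ∀ α β, α < β → (F β).Stronger (F α)) (i : Bool) {α β : ι} (h : α ≤ β) {b : B}
    (hb : ∀ᶠ n in atTop, e ((F α).c i n) ≤ b) : ∀ᶠ n in atTop, e ((F β).c i n) ≤ b := by
  filter_upwards [eventually_le_of_le hF i h, hb] with n h1 h2 using h1.trans h2

theorem inf_mem_towerFilter {F : ι → TowerCond e p}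
    (hF : ∀ α β, α < β → (F β).Stronger (F α)) {i : Bool} {a b : B}
    (ha : a ∈ towerFilter F i) (hb : b ∈ towerFilter F i) : a ⊓ b ∈ towerFilter F i := by
  obtain ⟨α, hα⟩ := ha
  obtain ⟨β, hβ⟩ := hb
  refine ⟨max α β, ?_⟩
  filter_upwards [eventually_le_mono hF i (le_max_left α β) hα,
    eventually_le_mono hF i (le_max_right α β) hβ] with n h1 h2 using le_inf h1 h2

theorem isBooleanUltrafilter_towerFilter [Nonempty ι] {F : ι → TowerCond e p}
    (hF : ∀ α β, α < β → (F β).Stronger (F α)) {i : Bool}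
    (hdec : ∀ b : B, ∃ α, (∀ᶠ n in atTop, e ((F α).c i n) ≤ b) ∨
      ∀ᶠ n in atTop, e ((F α).c i n) ≤ bᶜ) :
    IsBooleanUltrafilter (towerFilter F i) where
  isPFilter := by
    refine Order.IsPFilter.of_def ?_ ?_ ?_
    · exact ⟨⊤, Classical.arbitrary ι, Eventually.of_forall fun n => le_top⟩
    · intro a ha b hb
      exact ⟨a ⊓ b, inf_mem_towerFilter hF ha hb, inf_le_left, inf_le_right⟩
    · intro a b hab ha
      exact mem_towerFilter_of_le ha hab
  bot_notMem := bot_notMem_towerFilter F i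
  mem_or_compl_mem b := by
    obtain ⟨α, h | h⟩ := hdec b
    · exact Or.inl ⟨α, h⟩
    · exact Or.inr ⟨α, h⟩

theorem exists_seqSup_seqTail_le (he : e 0 = ⊥) {x : ℕ → ℕ} {b : B}
    (h : ∀ᶠ n in atTop, e (x n) ≤ b) : ∃ m, seqSup e (seqTail m x) ≤ b := by
  obtain ⟨m, hm⟩ := eventually_atTop.1 h
  refine ⟨m, iSup_le fun n => ?_⟩
  simp only [seqTail]
  split_ifs with h1
  · rw [he]; exact bot_le
  · exact hm n (not_lt.1 h1)

/-! ### Jipsen–Pinus–Rose reducibility -/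

/-- Both memberships say that, at some stage, `h n ∈ X` for almost all `n` in the common support: a
nonzero element below `h n` lies below `sSup X` only if `h n ∈ X`, and likewise for `p n`. -/
theorem iSup_mem_towerFilter_iff {F : ι → TowerCond e p}
    (hF : ∀ α β, α < β → (F β).Stronger (F α))
    (hp : Pairwise fun m n => Disjoint (p m) (p n)) (i j : Bool) {A : Set B}
    (hA : A.Pairwise Disjoint) {h : ℕ → B} (hhA : ∀ n, h n ∈ A) {α : ι}
    (hh : ∀ᶠ n in atTop, e ((F α).c i n) ≤ h n) {X : Set B} (hX : X ⊆ A) :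
    sSup X ∈ towerFilter F i ↔ sSup {c | ∃ n, h n ∈ X ∧ c = p n} ∈ towerFilter F j := by
  constructor
  · rintro ⟨β, hβ⟩
    refine ⟨max α β, ?_⟩
    filter_upwards [eventually_le_mono hF i (le_max_right α β) hβ,
      eventually_le_of_le hF i (le_max_left α β), hh, (F (max α β)).supp j i] with n h1 h2 h3 h4
    by_cases h5 : e ((F (max α β)).c j n) = ⊥
    · rw [h5]; exact bot_le
    · refine ((F (max α β)).le j n).trans (le_sSup ⟨n, ?_, rfl⟩)
      by_contra h6
      have h7 : Disjoint (h n) (sSup X) := by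
        rw [disjoint_sSup_iff]
        intro x hx
        exact hA (hhA n) (hX hx) fun h8 => h6 (h8 ▸ hx)
      exact h4 h5 (le_bot_iff.1 (h7 (h2.trans h3) h1))
  · rintro ⟨β, hβ⟩
    refine ⟨max α β, ?_⟩
    filter_upwards [eventually_le_mono hF j (le_max_right α β) hβ,
      eventually_le_of_le hF i (le_max_left α β), hh, (F (max α β)).supp i j] with n h1 h2 h3 h4
    by_cases h5 : e ((F (max α β)).c i n) = ⊥
    · rw [h5]; exact bot_le
    · refine (h2.trans h3).trans (le_sSup ?_)
      by_contra h6
      have h7 : Disjoint (p n) (sSup {c | ∃ n, h n ∈ X ∧ c = p n}) := by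
        rw [disjoint_sSup_iff]
        rintro _ ⟨m, hm, rfl⟩
        exact hp fun h8 => h6 (h8 ▸ hm)
      exact h4 h5 (le_bot_iff.1 (h7 ((F (max α β)).le j n) h1))

theorem jprLe_towerFilter {F : ι → TowerCond e p}
    (hF : ∀ α β, α < β → (F β).Stronger (F α)) (hp0 : ∀ n, p n ≠ ⊥)
    (hp : Pairwise fun m n => Disjoint (p m) (p n))
    (hmax : Maximal IsBooleanAntichain (Set.range p)) (i j : Bool)
    (href : ∀ A : MaxAntichains B, ∃ α,
      ∀ᶠ n in atTop, e ((F α).c i n) ≠ ⊥ → ∃ a ∈ A.1, e ((F α).c i n) ≤ a) :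
    JPRLe (towerFilter F i) (towerFilter F j) := by
  classical
  have hinj : Function.Injective p := by
    intro m n h
    by_contra h2
    have h3 := hp h2
    simp only [h, disjoint_self] at h3
    exact hp0 n h3
  have hh : ∀ A : MaxAntichains B, ∃ h : ℕ → A.1, ∃ α,
      ∀ᶠ n in atTop, e ((F α).c i n) ≤ (h n : B) := by
    intro A
    obtain ⟨a₀, ha₀, -⟩ := exists_inf_ne_bot_of_maximal A.2 (hp0 0)
    obtain ⟨α, hα⟩ := href A
    have : ∀ n, ∃ a : A.1, (∃ a ∈ A.1, e ((F α).c i n) ≤ a) → e ((F α).c i n) ≤ (a : B) := by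
      intro n
      by_cases h : ∃ a ∈ A.1, e ((F α).c i n) ≤ a
      · obtain ⟨a, ha, h2⟩ := h
        exact ⟨⟨a, ha⟩, fun _ => h2⟩
      · exact ⟨⟨a₀, ha₀⟩, fun h2 => absurd h2 h⟩
    choose h hh using this
    refine ⟨h, α, hα.mono fun n hn => ?_⟩
    by_cases h5 : e ((F α).c i n) = ⊥
    · rw [h5]; exact bot_le
    · exact hh n (hn h5)
  choose h α hα using hh
  let idx : Set.range p → ℕ := fun x => x.2.choose
  have hidx : ∀ x : Set.range p, p (idx x) = x := fun x => x.2.choose_spec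
  have hidx' : ∀ n (hn : p n ∈ Set.range p), idx ⟨p n, hn⟩ = n := fun n hn => hinj (hidx _)
  -- Every antichain is sent to the same `p`, so in the second clause the diagonal meets `p n ⊓ p n`
  -- suffice.
  refine ⟨fun _ => ⟨Set.range p, hmax⟩, fun A x => h A (idx x), ?_, ?_⟩
  · intro A X hX
    rw [iSup_mem_towerFilter_iff hF hp i j A.2.1.2 (fun n => (h A n).2) (hα A) hX]
    have : {c | ∃ n, (h A n : B) ∈ X ∧ c = p n} =
        {c : B | ∃ x : Set.range p, (h A (idx x) : B) ∈ X ∧ c = (x : B)} := by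
      ext c
      constructor
      · rintro ⟨n, hn, rfl⟩
        refine ⟨⟨p n, n, rfl⟩, ?_, rfl⟩
        rwa [hidx' n ⟨n, rfl⟩]
      · rintro ⟨x, hx, rfl⟩
        exact ⟨idx x, hx, (hidx x).symm⟩
    rw [this]
  · intro A A' hAA'
    refine ⟨max (α A) (α A'), ?_⟩
    filter_upwards [eventually_le_of_le hF i (le_max_left (α A) (α A')), hα A,
      eventually_le_of_le hF i (le_max_right (α A) (α A')), hα A',
      (F (max (α A) (α A'))).supp j i] with n h1 h2 h3 h4 h5
    by_cases h6 : e ((F (max (α A) (α A'))).c j n) = ⊥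
    · rw [h6]; exact bot_le
    refine ((F (max (α A) (α A'))).le j n).trans (le_sSup ?_)
    refine ⟨⟨p n, n, rfl⟩, ⟨p n, n, rfl⟩, ?_, (inf_idem _).symm⟩
    rw [hidx' n ⟨n, rfl⟩]
    obtain ⟨a, ha, hle⟩ := hAA' _ (h A' n).2
    -- Supports agree, so side `i` has a nonzero term here; it lies below both `a` and `h A n`.
    have : a = h A n := by
      by_contra hne
      have hd := A.2.1.2 ha (h A n).2 hne
      exact h5 h6 (le_bot_iff.1 (hd ((h3.trans h4).trans hle) (h1.trans h2)))
    rwa [this] at hle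

/-! ### Tukey reducibility -/

/-- A Tukey reduction induces a monotone map which sends bases to bases. -/
theorem TukeyLe.exists_monotone {U V : Set B} (hU : IsUpperSet U) (h : TukeyLe U V) :
    ∃ g : B → B, Monotone g ∧ (∀ v ∈ V, g v ∈ U) ∧ ∀ u ∈ U, ∃ v ∈ V, g v ≤ u := by
  obtain ⟨f, g, hfg⟩ := h
  -- For `v ∈ V` this infimum lies above the original `g v`, hence belongs to `U`.
  refine ⟨fun v => sInf {u | ∃ hu : u ∈ U, v ≤ f ⟨u, hu⟩}, ?_, ?_, ?_⟩
  · intro v v' hv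
    refine sInf_le_sInf ?_
    rintro u ⟨hu, h⟩
    exact ⟨hu, hv.trans h⟩
  · intro v hv
    refine hU (le_sInf ?_) (g ⟨v, hv⟩).2
    rintro u ⟨hu, h⟩
    exact hfg ⟨u, hu⟩ ⟨v, hv⟩ h
  · intro u hu
    exact ⟨f ⟨u, hu⟩, (f ⟨u, hu⟩).2, sInf_le ⟨hu, le_rfl⟩⟩

/-- The sequence which agrees with `y` below `n` and with `x` from `n` on. -/
def seqGlue (n : ℕ) (y x : ℕ → ℕ) : ℕ → ℕ := fun j => if j < n then y j else x j

theorem sSup_codes_le (hd : ∀ b : B, b ≠ ⊥ → ∃ k, e k ≠ ⊥ ∧ e k ≤ b) (b : B) :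
    b ≤ sSup {c | ∃ k, c = e k ∧ e k ≤ b} := by
  rw [← sdiff_eq_bot_iff]
  by_contra h
  obtain ⟨k, hk, hk2⟩ := hd _ h
  have h1 : e k ≤ sSup {c | ∃ k, c = e k ∧ e k ≤ b} := le_sSup ⟨k, rfl, hk2.trans sdiff_le⟩
  exact hk (le_bot_iff.1 (disjoint_sdiff_self_left hk2 h1))

/-- On the tails of a tower, every monotone map is eventually coded by a countable relation. -/
theorem exists_codedMap_eq [Nonempty ι] (hd : ∀ b : B, b ≠ ⊥ → ∃ k, e k ≠ ⊥ ∧ e k ≤ b)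
    (hbd : ∀ S : Set ι, S.Countable → ∃ β, ∀ α ∈ S, α < β)
    {F : ι → TowerCond e p} (hF : ∀ α β, α < β → (F β).Stronger (F α))
    (hgap : ∀ N, ∃ α, N ∈ (F α).gapFns) (i : Bool) {g : B → B} (hg : Monotone g) :
    ∃ (Ψ : Set (List ℕ × ℕ)) (α : ι), ∀ β, α < β → ∀ m,
      g (seqSup e (seqTail m ((F β).c i))) = codedMap e Ψ (seqTail m ((F β).c i)) := by
  classical
  -- `(l, k)` is admitted when `e k` lies below the value of `g` for every tail of every stage with
  -- its beginning replaced by `l`. Each pair not admitted has a counterexample; only countably many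
  -- arise, so one stage `α₀` lies beyond them all.
  let Ψ : Set (List ℕ × ℕ) := {t | ∀ γ m y, seqPrefix y t.1.length = t.1 →
    e t.2 ≤ g (seqSup e (seqGlue t.1.length y (seqTail m ((F γ).c i))))}
  have hw : ∀ l k, ∃ γ m y, (l, k) ∉ Ψ → seqPrefix y l.length = l ∧
      ¬ e k ≤ g (seqSup e (seqGlue l.length y (seqTail m ((F γ).c i)))) := by
    intro l k
    by_cases h : (l, k) ∈ Ψ
    · exact ⟨Classical.arbitrary ι, 0, 0, fun h2 => absurd h h2⟩
    · have h2 := h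
      simp only [Ψ, Set.mem_ofPred_eq] at h2
      push Not at h2
      obtain ⟨γ, m, y, h3, h4⟩ := h2
      exact ⟨γ, m, y, fun _ => ⟨h3, h4⟩⟩
  choose γ m y hy using hw
  obtain ⟨α₀, hα₀⟩ := hbd (Set.range fun t : List ℕ × ℕ => γ t.1 t.2) (Set.countable_range _)
  have hN : ∀ l k, ∃ N, ∀ n ≥ N,
      e ((F α₀).c i n) ≤ e (seqTail (m l k) ((F (γ l k)).c i) n) := by
    intro l k
    obtain ⟨N, hN⟩ := eventually_atTop.1 (eventually_le_of_le hF i (hα₀ _ ⟨(l, k), rfl⟩).le)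
    refine ⟨max N (m l k), fun n hn => ?_⟩
    simp only [seqTail, if_neg (not_lt.2 ((le_max_right _ _).trans hn))]
    exact hN n ((le_max_left _ _).trans hn)
  choose N hN using hN
  -- One promise handles all `k ≤ l.length`: past the bound, stage `α₀` lies below the
  -- counterexample's tail for `(l, k)`.
  obtain ⟨α₁, hα₁⟩ := hgap fun l => (Finset.range (l.length + 1)).sup (N l)
  refine ⟨Ψ, max α₀ α₁, fun β hβ r => ?_⟩
  have hβ₀ := (le_max_left α₀ α₁).trans_lt hβ
  have hβ₁ := (le_max_right α₀ α₁).trans_lt hβ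
  set v := seqTail r ((F β).c i) with hv
  apply le_antisymm
  · refine (sSup_codes_le hd _).trans (sSup_le_sSup ?_)
    rintro _ ⟨k, rfl, hk⟩
    obtain ⟨M, hM⟩ := eventually_atTop.1 (eventually_le_of_le hF i hβ₀.le)
    obtain ⟨n, hn, hn2⟩ := frequently_atTop.1 ((hF _ _ hβ₁).2.2 i _ hα₁ r) (max k (max M r))
    refine ⟨k, n, v, rfl, fun _ _ => le_rfl, ?_⟩
    by_contra h
    obtain ⟨h1, h2⟩ := hy _ _ h
    -- The counterexample dominates `v`: they agree below `n`, `v` vanishes in the gap, and beyond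
    -- it stage `α₀` lies in between.
    refine h2 (hk.trans (hg (iSup_mono fun j => ?_)))
    rw [length_seqPrefix] at h1 ⊢
    rw [seqPrefix_eq_iff] at h1
    simp only [seqGlue]
    split_ifs with h3
    · rw [h1 j h3]
    · rw [not_lt] at h3
      have hvj : v j = (F β).c i j := by
        simp only [hv, seqTail]
        rw [if_neg (by omega)]
      rw [hvj]
      by_cases h4 : j < N (seqPrefix v n) k
      · rw [hn2 j h3 (h4.trans_le ?_)]
        · exact bot_le
        · refine Finset.le_sup (f := N (seqPrefix v n)) ?_
          rw [length_seqPrefix, Finset.mem_range]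
          omega
      · exact (hM j (by omega)).trans (hN _ _ j (not_lt.1 h4))
  · refine sSup_le ?_
    rintro _ ⟨k, n, y', rfl, h1, h2⟩
    -- Replacing the beginning of `v` by the smaller `y'` gives a sequence below `v`.
    have h3 := h2 β r y' (by rw [length_seqPrefix])
    refine h3.trans (hg (iSup_mono fun j => ?_))
    simp only [length_seqPrefix, seqGlue]
    split_ifs with h4
    · exact h1 j h4
    · rfl

/-- The first form of `Kills` puts `bᶜ` and an element below `b` into one filter. In the second, `g
v ≤ b` for some `v` in the filter on side `j`, and a tail of a late stage with join below `v` is a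
forbidden `z`. -/
theorem not_tukeyLe_towerFilter [Nonempty ι] (he : e 0 = ⊥)
    (hd : ∀ b : B, b ≠ ⊥ → ∃ k, e k ≠ ⊥ ∧ e k ≤ b)
    (hbd : ∀ S : Set ι, S.Countable → ∃ β, ∀ α ∈ S, α < β)
    {F : ι → TowerCond e p} (hF : ∀ α β, α < β → (F β).Stronger (F α))
    (hgap : ∀ N, ∃ α, N ∈ (F α).gapFns) (j : Bool)
    (hkill : ∀ Ψ α, ∃ β, α < β ∧ (F β).Kills Ψ j) :
    ¬ TukeyLe (towerFilter F (!j)) (towerFilter F j) := by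
  intro hT
  obtain ⟨g, hg, hgU, hgc⟩ := hT.exists_monotone fun a b hab ha => mem_towerFilter_of_le ha hab
  obtain ⟨Ψ, α, hΨ⟩ := exists_codedMap_eq hd hbd hF hgap j hg
  obtain ⟨β, hαβ, ⟨b, hb, hb2⟩ | ⟨b, hb, hb2⟩⟩ := hkill Ψ α
  · have h1 := hΨ β hαβ 0
    rw [seqTail_zero] at h1
    have h2 := hgU _ (seqSup_mem_towerFilter F j β)
    rw [h1] at h2
    have h3 := inf_mem_towerFilter hF (mem_towerFilter_of_le h2 hb2)
      (show bᶜ ∈ towerFilter F (!j) from ⟨β, hb⟩)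
    rw [inf_compl_self] at h3
    exact bot_notMem_towerFilter _ _ h3
  · obtain ⟨v, ⟨γ, hγ⟩, hv⟩ := hgc b ⟨β, hb⟩
    have hβ := le_max_left β γ
    obtain ⟨m, hm⟩ := exists_seqSup_seqTail_le he
      (eventually_le_mono hF j (le_max_right β γ) hγ)
    have htail : ∀ᶠ n in atTop,
        seqTail m ((F (max β γ)).c j) n = (F (max β γ)).c j n := by
      filter_upwards [eventually_ge_atTop m] with n hn
      simp [seqTail, hn]
    refine hb2 (seqTail m ((F (max β γ)).c j)) ?_ ?_ ?_
    · refine (((F (max β γ)).inf j).and_eventually htail).mono fun n hn => ?_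
      rw [hn.2]
      exact hn.1
    · filter_upwards [htail, eventually_le_of_le hF j hβ] with n h1 h2
      rw [h1]
      exact h2
    · rw [← hΨ _ (hαβ.trans_le hβ) m]
      exact (hg hm).trans hv

end Towers

/-! ### The Cohen algebra -/

theorem IsCohenAlgebra.exists_codes {B : Type*} [CompleteBooleanAlgebra B]
    (hB : IsCohenAlgebra B) :
    ∃ e : ℕ → B, e 0 = ⊥ ∧ ∀ b : B, b ≠ ⊥ → ∃ k, e k ≠ ⊥ ∧ e k ≤ b := by
  obtain ⟨D, hD, hdense⟩ := hB.exists_countable_dense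
  obtain ⟨e, he⟩ := hD.exists_eq_range ⟨⊥, D.bot_mem⟩
  refine ⟨fun n => Nat.casesOn n ⊥ e, rfl, fun b hb => ?_⟩
  obtain ⟨d, hd, hd0, hdb⟩ := hdense b hb
  have : d ∈ Set.range e := he ▸ hd
  obtain ⟨k, rfl⟩ := this
  exact ⟨k + 1, hd0, hdb⟩

theorem exists_infinite_maximal_antichain {B : Type*} [CompleteBooleanAlgebra B] [Nontrivial B]
    (hat : ∀ b : B, ¬ IsAtom b) :
    ∃ p : ℕ → B, (∀ n, p n ≠ ⊥) ∧ (Pairwise fun m n => Disjoint (p m) (p n)) ∧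
      Maximal IsBooleanAntichain (Set.range p) := by
  classical
  have hlt : ∀ b : {b : B // b ≠ ⊥}, ∃ x : {b : B // b ≠ ⊥}, (x : B) < b := by
    rintro ⟨b, hb⟩
    by_contra! h
    refine hat b ⟨hb, fun x hx => ?_⟩
    by_contra hx0
    exact h ⟨x, hx0⟩ hx
  choose nx hnx using hlt
  let q : ℕ → {b : B // b ≠ ⊥} := fun n => nx^[n] ⟨⊤, top_ne_bot⟩
  have hq : ∀ n, (q (n + 1) : B) < q n := fun n => by
    simp only [q, Function.iterate_succ_apply']
    exact hnx _
  have hanti : Antitone fun n => (q n : B) := antitone_nat_of_succ_le fun n => (hq n).le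
  let a : ℕ → B := fun n => (q n : B) \ q (n + 1)
  have ha0 : ∀ n, a n ≠ ⊥ := fun n h => (hq n).not_ge (sdiff_eq_bot_iff.1 h)
  have hadlt : ∀ m n, m < n → Disjoint (a m) (a n) := fun m n h =>
    disjoint_sdiff_self_left.mono_right (sdiff_le.trans (hanti h))
  have had : ∀ m n, m ≠ n → Disjoint (a m) (a n) := fun m n h => by
    rcases h.lt_or_gt with h | h
    · exact hadlt m n h
    · exact (hadlt n m h).symm
  -- Taking the complement of all other members as `p 0` gives maximality; it is nonzero because it
  -- contains `a 0`.
  let p : ℕ → B := fun n => Nat.casesOn n (⨆ n, a (n + 1))ᶜ fun n => a (n + 1)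
  have hp0 : p 0 = (⨆ n, a (n + 1))ᶜ := rfl
  have hps : ∀ n, p (n + 1) = a (n + 1) := fun n => rfl
  have hdisj0 : ∀ n, Disjoint (p 0) (p (n + 1)) := fun n => by
    rw [hp0, hps]
    exact disjoint_compl_left.mono_right (le_iSup (fun n => a (n + 1)) n)
  have hne : ∀ n, p n ≠ ⊥ := by
    rintro (_ | n)
    · have : a 0 ≤ p 0 := by
        rw [hp0, le_compl_iff_disjoint_right, disjoint_iSup_iff]
        exact fun n => had _ _ (by omega)
      intro h
      rw [h, le_bot_iff] at this
      exact ha0 0 this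
    · exact ha0 _
  have hdisj : Pairwise fun m n => Disjoint (p m) (p n) := by
    rintro (_ | m) (_ | n) h
    · exact absurd rfl h
    · exact hdisj0 n
    · exact (hdisj0 m).symm
    · exact had _ _ h
  refine ⟨p, hne, hdisj, ⟨?_, ?_⟩, ?_⟩
  · rintro ⟨n, hn⟩
    exact hne n hn
  · rintro _ ⟨m, rfl⟩ _ ⟨n, rfl⟩ h
    exact hdisj fun h2 => h (by rw [h2])
  · intro A hA hpA x hx
    by_contra hxp
    have h1 : ∀ n, Disjoint x (p n) := fun n =>
      hA.2 hx (hpA ⟨n, rfl⟩) fun h => hxp ⟨n, h.symm⟩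
    have h2 : x ≤ p 0 := by
      rw [hp0, le_compl_iff_disjoint_right, disjoint_iSup_iff]
      exact fun n => h1 (n + 1)
    have h3 : x = ⊥ := le_bot_iff.1 (h1 0 le_rfl h2)
    exact hA.1 (h3 ▸ hx)

/-- The requirements that are met in the construction of the tower. -/
abbrev TowerTask (B : Type*) [CompleteBooleanAlgebra B] : Type _ :=
  (B ⊕ MaxAntichains B ⊕ (List ℕ → ℕ) ⊕ Set (List ℕ × ℕ)) × Bool

theorem le_of_codes_le {B : Type*} [CompleteBooleanAlgebra B] {e : ℕ → B}
    (hd : ∀ b : B, b ≠ ⊥ → ∃ k, e k ≠ ⊥ ∧ e k ≤ b) {a b : B}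
    (h : ∀ k, e k ≤ a → e k ≤ b) : a ≤ b := by
  rw [← sdiff_eq_bot_iff]
  by_contra h2
  obtain ⟨k, hk, hk2⟩ := hd _ h2
  exact hk (le_bot_iff.1 (disjoint_sdiff_self_left hk2 (h k (hk2.trans sdiff_le))))

/-- A code `k` of a nonzero element below `a ∈ A` singles out `a`, which is then the join of all `e
l` with `(k, l)` in the set. -/
theorem MaxAntichains.injective_codes {B : Type*} [CompleteBooleanAlgebra B] {e : ℕ → B}
    (hd : ∀ b : B, b ≠ ⊥ → ∃ k, e k ≠ ⊥ ∧ e k ≤ b) :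
    Function.Injective fun A : MaxAntichains B =>
      {t : ℕ × ℕ | e t.1 ≠ ⊥ ∧ ∃ a ∈ A.1, e t.1 ≤ a ∧ e t.2 ≤ a} := by
  have key : ∀ A A' : MaxAntichains B,
      {t : ℕ × ℕ | e t.1 ≠ ⊥ ∧ ∃ a ∈ A.1, e t.1 ≤ a ∧ e t.2 ≤ a} =
      {t : ℕ × ℕ | e t.1 ≠ ⊥ ∧ ∃ a ∈ A'.1, e t.1 ≤ a ∧ e t.2 ≤ a} → A.1 ⊆ A'.1 := by
    intro A A' h a ha
    have ha0 : a ≠ ⊥ := fun h0 => A.2.1.1 (h0 ▸ ha)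
    obtain ⟨k, hk, hka⟩ := hd a ha0
    have huniq : ∀ (C : MaxAntichains B), ∀ x ∈ C.1, ∀ y ∈ C.1, e k ≤ x → e k ≤ y → x = y := by
      intro C x hx y hy h1 h2
      by_contra hne
      exact hk (le_bot_iff.1 (C.2.1.2 hx hy hne h1 h2))
    have h1 : (k, k) ∈ {t : ℕ × ℕ | e t.1 ≠ ⊥ ∧ ∃ a ∈ A'.1, e t.1 ≤ a ∧ e t.2 ≤ a} := by
      rw [← h]
      exact ⟨hk, a, ha, hka, hka⟩
    obtain ⟨-, a', ha', hka', -⟩ := h1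
    have : a = a' := by
      apply le_antisymm
      · refine le_of_codes_le hd fun l hl => ?_
        have h2 : (k, l) ∈ {t : ℕ × ℕ | e t.1 ≠ ⊥ ∧ ∃ a ∈ A'.1, e t.1 ≤ a ∧ e t.2 ≤ a} := by
          rw [← h]
          exact ⟨hk, a, ha, hka, hl⟩
        obtain ⟨-, x, hx, h3, h4⟩ := h2
        rwa [huniq A' a' ha' x hx hka' h3]
      · refine le_of_codes_le hd fun l hl => ?_
        have h2 : (k, l) ∈ {t : ℕ × ℕ | e t.1 ≠ ⊥ ∧ ∃ a ∈ A.1, e t.1 ≤ a ∧ e t.2 ≤ a} := by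
          rw [h]
          exact ⟨hk, a', ha', hka', hl⟩
        obtain ⟨-, x, hx, h3, h4⟩ := h2
        rwa [huniq A a ha x hx hka h3]
    rwa [this]
  intro A A' h
  exact Subtype.ext (Set.Subset.antisymm (key A A' h) (key A' A h.symm))

theorem exists_surjective_towerTask {B : Type*} [CompleteBooleanAlgebra B] {e : ℕ → B}
    (hd : ∀ b : B, b ≠ ⊥ → ∃ k, e k ≠ ⊥ ∧ e k ≤ b) :
    ∃ f : Set ℕ → TowerTask B, Function.Surjective f := by
  have h1 : Function.Injective fun b : B => {k | e k ≤ b} := by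
    intro a b h
    have h2 : ∀ k, e k ≤ a ↔ e k ≤ b := fun k => Set.ext_iff.1 h k
    exact le_antisymm (le_of_codes_le hd fun k => (h2 k).1) (le_of_codes_le hd fun k => (h2 k).2)
  have h2 := Function.Injective.prodMap
    (Function.Injective.sumMap h1 (Function.Injective.sumMap (MaxAntichains.injective_codes hd)
      (Function.injective_id (α := (List ℕ → ℕ) ⊕ Set (List ℕ × ℕ)))))
    (Function.injective_id (α := Bool))
  have hcard : Cardinal.mk ((Set ℕ ⊕ Set (ℕ × ℕ) ⊕ (List ℕ → ℕ) ⊕ Set (List ℕ × ℕ)) × Bool)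
      ≤ Cardinal.mk (Set ℕ) := by
    simp
  obtain ⟨E⟩ := hcard
  have h3 := E.injective.comp h2
  have : Nonempty (TowerTask B) := ⟨(Sum.inl ⊥, true)⟩
  exact ⟨_, Function.invFun_surjective h3⟩

theorem mainTheorem4 (hCH : (2 : Cardinal.{0}) ^ Cardinal.aleph0.{0} = Cardinal.aleph 1)
    {B : Type*} [CompleteBooleanAlgebra B] (hB : IsCohenAlgebra B) :
    ∃ U V : Set B, IsBooleanUltrafilter U ∧ IsBooleanUltrafilter V ∧
      JPREquiv U V ∧ ¬ TukeyLe U V ∧ ¬ TukeyLe V U := by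
  have := hB.nontrivial
  obtain ⟨e, he, hd⟩ := hB.exists_codes
  obtain ⟨p, hp0, hp, hmax⟩ := exists_infinite_maximal_antichain hB.atomless
  obtain ⟨ι, _, _, s, hι, hbd, hs⟩ :=
    exists_cofinal_enumeration hCH (exists_surjective_towerTask hd)
  have : Nonempty ι := ⟨(hbd ∅ Set.countable_empty).choose⟩
  have hne : Nonempty (TowerCond e p) := by
    have : ∀ n, ∃ k, e k ≠ ⊥ ∧ e k ≤ p n := fun n => hd _ (hp0 n)
    choose x hx hxp using this
    exact ⟨⟨fun _ => x, ∅, fun _ => hxp, fun _ _ => Eventually.of_forall fun n _ => hx n,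
      fun _ => Frequently.of_forall hx, Set.countable_empty⟩⟩
  let D : TowerTask B → Set (TowerCond e p) := fun t => {q |
    Sum.elim
      (fun b => (∀ᶠ n in atTop, e (q.c t.2 n) ≤ b) ∨ ∀ᶠ n in atTop, e (q.c t.2 n) ≤ bᶜ)
      (Sum.elim
        (fun A => ∀ᶠ n in atTop, e (q.c t.2 n) ≠ ⊥ → ∃ a ∈ A.1, e (q.c t.2 n) ≤ a)
        (Sum.elim (fun N => N ∈ q.gapFns) fun Ψ => q.Kills Ψ t.2)) t.1}
  obtain ⟨F, hF, hFD⟩ := exists_generic_tower TowerCond.Stronger TowerCond.Stronger.trans hne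
    (fun S hS hSne hc => (TowerCond.exists_lower he S hS hSne hc).imp fun q hq => hq.1) D
    (by
      rintro ⟨b | A | N | Ψ, i⟩ q
      · exact q.exists_stronger_decides he hd i b
      · exact q.exists_stronger_refines he hd i A
      · exact q.exists_stronger_mem_gapFns he N
      · exact q.exists_stronger_kills he hd hB.atomless hp Ψ i) hι s
  -- Cofinality matters for `Kills`, which must happen beyond the stage where the coding of `g`
  -- becomes valid.
  have hmeet : ∀ t α, ∃ β, α < β ∧ F β ∈ D t := fun t α => by
    obtain ⟨β, hβ, rfl⟩ := hs t α
    exact ⟨β, hβ, hFD β⟩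
  have hmeet' : ∀ t, ∃ β, F β ∈ D t := fun t =>
    (hmeet t (Classical.arbitrary ι)).imp fun β hβ => hβ.2
  have hult : ∀ i, IsBooleanUltrafilter (towerFilter F i) := fun i =>
    isBooleanUltrafilter_towerFilter hF fun b => hmeet' (Sum.inl b, i)
  have hjpr : ∀ i j, JPRLe (towerFilter F i) (towerFilter F j) := fun i j =>
    jprLe_towerFilter hF hp0 hp hmax i j fun A => hmeet' (Sum.inr (Sum.inl A), i)
  have htukey : ∀ j, ¬ TukeyLe (towerFilter F (!j)) (towerFilter F j) := fun j =>
    not_tukeyLe_towerFilter he hd hbd hF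
      (fun N => hmeet' (Sum.inr (Sum.inr (Sum.inl N)), j)) j
      fun Ψ => hmeet (Sum.inr (Sum.inr (Sum.inr Ψ)), j)
  exact ⟨towerFilter F false, towerFilter F true, hult _, hult _, ⟨hjpr _ _, hjpr _ _⟩,
    htukey true, htukey false⟩
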